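/- Let $G_1=\langle X_1\mid R_1\rangle$ and $G_2=\langle X_2\mid R_2\rangle$ be finite groups given by finite presentations on disjoint alphabets, let $A$ be a group with monomorphisms $\phi_i:A\to G_i$ ($i=1,2$), let $G=G_1*_A G_2$ be the corresponding amalgam, and put $X=X_1\sqcup X_2$. For a subgroup $H\le G$, let $Cayley(G,H)$ be the relative Cayley graph: its vertices are the right cosets $Hg$, and for each letter $x\in X^{\pm}$ (where $X^{\pm}$ consists of the letters of $X$ and their formal inverses) there is an edge $(Hg,x)$ with label $x$ from $Hg$ to $Hgx$, whose inverse edge is $(Hgx,x^{-1})$. Call a path in $Cayley(G,H)$ normal if, writing its label as $w_1w_2\cdots w_n$ ($n\ge 0$) with the $w_k$ its maximal nonempty subwords over a single alphabet $X_1^{\pm}$ or $X_2^{\pm}$, every $w_k$ represents a nontrivial element of $G$ and, if $n\neq 1$, no $w_k$ represents an element of $A$. The normal core of $Cayley(G,H)$ is the full subgraph of $Cayley(G,H)$ spanned by the essential vertices, i.e. those lying on some normal path which starts and ends at the vertex $H\cdot 1$. If $H$ is a finitely generated subgroup of $G$, then the normal core of $Cayley(G,H)$ is a finite graph (it has finitely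 many vertices and finitely many edges). -/

import Mathlib

/-- A graph in the sense of Serre, labelled with `X^± = X × Bool`
(`(x, true)` stands for `x` and `(x, false)` for its formal inverse). -/
structure LabelledGraph (X : Type*) where
  V : Type*
  E : Type*
  init : E → V
  rev : E → E
  rev_rev : ∀ e, rev (rev e) = e
  rev_ne : ∀ e, rev e ≠ e
  lab : E → X × Bool
  lab_rev : ∀ e, lab (rev e) = ((lab e).1, !(lab e).2)

namespace LabelledGraph

variable {X : Type*}

/-- The terminal vertex of an edge. -/
def term (Γ : LabelledGraph X) (e : Γ.E) : Γ.V := Γ.init (Γ.rev e)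

/-- `Γ.IsPath v p w`: the sequence of edges `p` is a path from `v` to `w`. -/
def IsPath (Γ : LabelledGraph X) : Γ.V → List Γ.E → Γ.V → Prop
  | v, [], w => v = w
  | v, e :: p, w => Γ.init e = v ∧ Γ.IsPath (Γ.term e) p w

/-- The vertices through which the path `p` starting at `v` goes (endpoints included). -/
def pathVertices (Γ : LabelledGraph X) (v : Γ.V) (p : List Γ.E) : List Γ.V :=
  v :: p.map Γ.term

/-- The label of a path, a word over `X^±`. -/
def pathLabel (Γ : LabelledGraph X) (p : List Γ.E) : List (X × Bool) := p.map Γ.lab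

theorem init_rev (Γ : LabelledGraph X) (e : Γ.E) : Γ.init (Γ.rev e) = Γ.term e := rfl

theorem term_rev (Γ : LabelledGraph X) (e : Γ.E) : Γ.term (Γ.rev e) = Γ.init e := by
  rw [term, Γ.rev_rev]

/-- The restriction of a graph to a set `S` of vertices: all the vertices in `S`, and all the
edges with both endpoints in `S`. -/
def restrict (Γ : LabelledGraph X) (S : Set Γ.V) : LabelledGraph X where
  V := S
  E := {e : Γ.E // Γ.init e ∈ S ∧ Γ.term e ∈ S}
  init e := ⟨Γ.init e.1, e.2.1⟩
  rev e := ⟨Γ.rev e.1, by rw [init_rev]; exact e.2.2, by rw [term_rev]; exact e.2.1⟩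
  rev_rev e := Subtype.ext (Γ.rev_rev e.1)
  rev_ne e h := Γ.rev_ne e.1 (congrArg Subtype.val h)
  lab e := Γ.lab e.1
  lab_rev e := Γ.lab_rev e.1

/-- A graph is finite if it has finitely many vertices and finitely many edges. -/
def IsFinite (Γ : LabelledGraph X) : Prop := Finite Γ.V ∧ Finite Γ.E

end LabelledGraph

section Cayley

variable {X G : Type*} [Group G]

/-- `G = gp⟨X | R⟩`, where `x` sends each letter of `X` to the element of `G` it denotes. -/
def IsPresentation (x : X → G) (R : Set (FreeGroup X)) : Prop :=
  Function.Surjective (FreeGroup.lift x) ∧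
    (FreeGroup.lift x).ker = Subgroup.normalClosure R

/-- The element of `G` denoted by a letter of `X^±`. -/
def letterVal (x : X → G) (a : X × Bool) : G := if a.2 then x a.1 else (x a.1)⁻¹

/-- The element of `G` denoted by a word over `X^±`. -/
def wordVal (x : X → G) (w : List (X × Bool)) : G := (w.map (letterVal x)).prod

/-- The right cosets `Hg` of `H` in `G`. -/
abbrev RightCosets (H : Subgroup G) : Type _ := Quotient (QuotientGroup.rightRel H)

/-- `Hg ↦ Hgk`. -/
def RightCosets.mulRight {H : Subgroup G} (c : RightCosets H) (k : G) : RightCosets H :=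
  Quotient.map' (· * k) (fun a b h => by
    rw [QuotientGroup.rightRel_apply] at h ⊢
    simpa [mul_assoc] using h) c

theorem RightCosets.mulRight_mulRight {H : Subgroup G} (c : RightCosets H) (k l : G) :
    (c.mulRight k).mulRight l = c.mulRight (k * l) := by
  induction c using Quotient.inductionOn'
  simp [RightCosets.mulRight, mul_assoc]

theorem RightCosets.mulRight_one {H : Subgroup G} (c : RightCosets H) : c.mulRight 1 = c := by
  induction c using Quotient.inductionOn'
  simp [RightCosets.mulRight]

theorem letterVal_mul_inv (x : X → G) (a : X × Bool) :
    letterVal x a * letterVal x (a.1, !a.2) = 1 := by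
  rcases a with ⟨a, _ | _⟩ <;> simp [letterVal]

/-- The relative Cayley graph `Cayley(G, H)` with respect to the generators `x`: the vertices are
the right cosets of `H`, and the edge `(Hg, a)`, `a ∈ X^±`, is labelled by `a`, begins at `Hg` and
ends at `Hga`. -/
def relCayley (x : X → G) (H : Subgroup G) : LabelledGraph X where
  V := RightCosets H
  E := RightCosets H × (X × Bool)
  init e := e.1
  rev e := (e.1.mulRight (letterVal x e.2), (e.2.1, !e.2.2))
  rev_rev e := by
    simp [RightCosets.mulRight_mulRight, letterVal_mul_inv, RightCosets.mulRight_one]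
  rev_ne e h := by
    have := congrArg (fun t => t.2.2) h
    simp at this
  lab e := e.2
  lab_rev _ := rfl

theorem relCayley_term (x : X → G) (H : Subgroup G) (c : RightCosets H) (a : X × Bool) :
    (relCayley x H).term (c, a) = c.mulRight (letterVal x a) := rfl

/-- The basepoint `H · 1` of `Cayley(G, H)`. -/
def relCayley.base (x : X → G) (H : Subgroup G) : (relCayley x H).V :=
  (Quotient.mk'' (1 : G) : RightCosets H)

end Cayley

section Amalgam

open Monoid

variable {A : Type*} [Group A] {G : Fin 2 → Type*} [∀ i, Group (G i)]
  {X : Fin 2 → Type*}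

/-- The letters of the disjoint union `X = X₁ ∪ X₂` as elements of the amalgam `G₁ *_A G₂`. -/
def amalgamGen (φ : ∀ i, A →* G i) (x : ∀ i, X i → G i) (a : Σ i, X i) : PushoutI φ :=
  PushoutI.of a.1 (x a.1 a.2)

/-- The sequence `(g₁, …, gₙ)` of elements of the amalgam `G₁ *_A G₂` is in normal form. -/
structure IsNormalSeq (φ : ∀ i, A →* G i) (gs : List (PushoutI φ)) : Prop where
  ne_one : ∀ g ∈ gs, g ≠ 1
  mem_factor : ∀ g ∈ gs, ∃ i, g ∈ (PushoutI.of (φ := φ) i).range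
  alternate : gs.IsChain fun g h => ∃ i j, i ≠ j ∧
    g ∈ (PushoutI.of (φ := φ) i).range ∧ h ∈ (PushoutI.of (φ := φ) j).range
  notMem_base : gs.length ≠ 1 → ∀ g ∈ gs, g ∉ (PushoutI.base φ).range

/-- `L` is the decomposition of the word `w` over `X₁^± ∪ X₂^±` into its maximal monochromatic
subwords: the words in `L` are nonempty, all the letters of each have the same colour, and
neighbouring words have different colours. -/
def IsMonochromaticDecomp (w : List ((Σ i, X i) × Bool)) (L : List (List ((Σ i, X i) × Bool))) :
    Prop :=
  L.flatten = w ∧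
  (∀ u ∈ L, u ≠ [] ∧ ∃ i, ∀ a ∈ u, a.1.1 = i) ∧
  L.IsChain fun u v => ∀ a ∈ u, ∀ b ∈ v, a.1.1 ≠ b.1.1

/-- A word over `X₁^± ∪ X₂^±` is in normal form if the elements of `G₁ *_A G₂` denoted by its
maximal monochromatic subwords form a sequence in normal form. -/
def IsNormalWord (φ : ∀ i, A →* G i) (x : ∀ i, X i → G i) (w : List ((Σ i, X i) × Bool)) : Prop :=
  ∃ L, IsMonochromaticDecomp w L ∧ IsNormalSeq φ (L.map (wordVal (amalgamGen φ x)))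

/-- A vertex of `Cayley(G, H)` is essential if some normal path closed at `H · 1` goes through
it. -/
def IsEssential (φ : ∀ i, A →* G i) (x : ∀ i, X i → G i) (H : Subgroup (PushoutI φ))
    (v : (relCayley (amalgamGen φ x) H).V) : Prop :=
  ∃ p : List (relCayley (amalgamGen φ x) H).E,
    (relCayley (amalgamGen φ x) H).IsPath (relCayley.base _ H) p (relCayley.base _ H) ∧
    IsNormalWord φ x ((relCayley (amalgamGen φ x) H).pathLabel p) ∧
    v ∈ (relCayley (amalgamGen φ x) H).pathVertices (relCayley.base _ H) p

/-- The normal core of `Cayley(G, H)`: its restriction to the set of the essential vertices. -/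
def normalCore (φ : ∀ i, A →* G i) (x : ∀ i, X i → G i) (H : Subgroup (PushoutI φ)) :
    LabelledGraph (Σ i, X i) :=
  (relCayley (amalgamGen φ x) H).restrict {v | IsEssential φ x H v}

/-- The empty path is normal, so the basepoint is a vertex of the normal core. -/
theorem isEssential_base (φ : ∀ i, A →* G i) (x : ∀ i, X i → G i) (H : Subgroup (PushoutI φ)) :
    IsEssential φ x H (relCayley.base _ H) := by
  refine ⟨[], rfl, ⟨[], ⟨rfl, by simp, by simp⟩, ⟨?_, ?_, ?_, ?_⟩⟩, ?_⟩ <;>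
    simp [LabelledGraph.pathVertices]

/-- The basepoint of the normal core. -/
def normalCore.base (φ : ∀ i, A →* G i) (x : ∀ i, X i → G i) (H : Subgroup (PushoutI φ)) :
    (normalCore φ x H).V :=
  ⟨relCayley.base _ H, isEssential_base φ x H⟩

end Amalgam

/-!
The left cosets `gA` are the edges of the Bass–Serre tree of `G`. The translate by `g ∈ G` of the
geodesic from `A` to `cA` is the geodesic from `gA` to `gcA`, so it lies in the geodesic from `A` to
`gcA` up to finitely many edges that do not depend on `c`. Apply this to the inverses of finitely
many monoid generators of `H`: by induction on the length of `h ∈ H`, the geodesic from `A` to `hA`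
lies in `H · D`, where `D` is a finite set of edges independent of `h`.

The syllables of a normal word representing `h ∈ H` are the steps of such a geodesic, so a prefix of
the word represents `q g`, where `qA` is an edge of the geodesic and `g` (an incomplete syllable)
lies in `G₁` or `G₂`. Since `A`, `G₁` and `G₂` are finite, this leaves finitely many cosets `H q g`.
-/

theorem exists_eq_flatten_append_of_prefix_flatten {α : Type*} {l : List α} {L : List (List α)}
    (hl : l <+: L.flatten) :
    ∃ L' v, L' <+: L ∧ l = L'.flatten ++ v ∧ (v = [] ∨ ∃ u ∈ L, v <+: u) := by
  induction L generalizing l with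
  | nil => exact ⟨[], [], List.prefix_rfl, List.prefix_nil.1 hl, Or.inl rfl⟩
  | cons u L ih =>
    rw [List.flatten_cons] at hl
    rcases List.prefix_or_prefix_of_prefix hl (List.prefix_append u L.flatten) with h | ⟨t, rfl⟩
    · exact ⟨[], l, List.nil_prefix, rfl, Or.inr ⟨u, List.mem_cons_self, h⟩⟩
    · obtain ⟨L', v, hL', rfl, hv⟩ := ih ((List.prefix_append_right_inj u).1 hl)
      exact ⟨u :: L', v, List.cons_prefix_cons.2 ⟨rfl, hL'⟩, by simp,
        hv.imp_right fun ⟨u', hu', h⟩ => ⟨u', List.mem_cons_of_mem u hu', h⟩⟩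

namespace LabelledGraph

variable {X : Type*} {Γ : LabelledGraph X}

theorem IsPath.exists_prefix_of_mem_pathVertices {p : List Γ.E} {v w u : Γ.V}
    (hp : Γ.IsPath v p w) (hu : u ∈ Γ.pathVertices v p) : ∃ q, q <+: p ∧ Γ.IsPath v q u := by
  induction p generalizing v with
  | nil => exact ⟨[], List.prefix_rfl, (List.mem_singleton.1 hu).symm⟩
  | cons e p ih =>
    obtain ⟨rfl, hp⟩ := hp
    rcases List.mem_cons.1 hu with rfl | hu
    · exact ⟨[], List.nil_prefix, rfl⟩
    · obtain ⟨q, hqp, hq⟩ := ih hp hu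
      exact ⟨e :: q, List.cons_prefix_cons.2 ⟨rfl, hqp⟩, rfl, hq⟩

end LabelledGraph

section Cayley

variable {X G : Type*} [Group G]

theorem wordVal_append (x : X → G) (u v : List (X × Bool)) :
    wordVal x (u ++ v) = wordVal x u * wordVal x v := by
  simp [wordVal]

theorem wordVal_flatten (x : X → G) (L : List (List (X × Bool))) :
    wordVal x L.flatten = (L.map (wordVal x)).prod := by
  simp only [wordVal, List.map_flatten, List.prod_flatten, List.map_map]
  rfl

theorem wordVal_mem {x : X → G} {K : Subgroup G} {w : List (X × Bool)}
    (hw : ∀ a ∈ w, x a.1 ∈ K) : wordVal x w ∈ K := by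
  refine list_prod_mem (List.forall_mem_map.2 fun a ha => ?_)
  unfold letterVal
  split
  · exact hw a ha
  · exact inv_mem (hw a ha)

variable {x : X → G} {H : Subgroup G}

theorem relCayley_eq_mulRight_of_isPath {p : List (relCayley x H).E} {c d : RightCosets H}
    (hp : (relCayley x H).IsPath c p d) :
    d = c.mulRight (wordVal x ((relCayley x H).pathLabel p)) := by
  induction p generalizing c with
  | nil => exact hp.symm.trans c.mulRight_one.symm
  | cons e p ih =>
    obtain ⟨rfl, hp⟩ := hp
    exact (ih hp).trans (RightCosets.mulRight_mulRight e.1 (letterVal x e.2) _)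

theorem relCayley_eq_mk_of_isPath_base {p : List (relCayley x H).E} {v : RightCosets H}
    (hp : (relCayley x H).IsPath (relCayley.base x H) p v) :
    v = Quotient.mk'' (wordVal x ((relCayley x H).pathLabel p)) :=
  (relCayley_eq_mulRight_of_isPath hp).trans (congrArg Quotient.mk'' (one_mul _))

theorem wordVal_pathLabel_mem_of_isPath_base {p : List (relCayley x H).E}
    (hp : (relCayley x H).IsPath (relCayley.base x H) p (relCayley.base x H)) :
    wordVal x ((relCayley x H).pathLabel p) ∈ H := by
  have h := QuotientGroup.rightRel_apply.1 (Quotient.exact (relCayley_eq_mk_of_isPath_base hp))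
  simpa using h

theorem relCayley_restrict_isFinite [Finite X] {S : Set (relCayley x H).V} (hS : S.Finite) :
    ((relCayley x H).restrict S).IsFinite := by
  have : Finite S := hS
  refine ⟨this, Finite.of_injective
    (fun e : ((relCayley x H).restrict S).E =>
      ((⟨e.1.1, e.2.1⟩ : S), e.1.2)) fun e e' h => ?_⟩
  obtain ⟨hvertex, hletter⟩ := Prod.ext_iff.1 h
  exact Subtype.ext (Prod.ext (congrArg Subtype.val hvertex) hletter)

end Cayley

section PrefixCosets

open scoped Pointwise

variable {P : Type*} [Group P]

/-- The left cosets `g₁ ⋯ gₖ B` of the partial products of a sequence `g₁, …, gₙ`, `0 ≤ k ≤ n`. -/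
def prefixCosets (B : Subgroup P) (gs : List P) : Set (P ⧸ B) :=
  {p | ∃ l, l <+: gs ∧ (l.prod : P ⧸ B) = p}

theorem prefixCosets_nil (B : Subgroup P) : prefixCosets B [] = {((1 : P) : P ⧸ B)} := by
  ext p
  simp [prefixCosets, eq_comm]

theorem prefixCosets_cons (B : Subgroup P) (g : P) (gs : List P) :
    prefixCosets B (g :: gs) = insert ((1 : P) : P ⧸ B) (g • prefixCosets B gs) := by
  ext p
  simp only [prefixCosets, Set.mem_ofPred_eq, List.prefix_cons_iff, Set.mem_insert_iff,
    Set.mem_smul_set]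
  constructor
  · rintro ⟨_, rfl | ⟨l, rfl, hl⟩, rfl⟩
    · exact Or.inl rfl
    · exact Or.inr ⟨_, ⟨l, hl, rfl⟩, by simp⟩
  · rintro (rfl | ⟨_, ⟨l, hl, rfl⟩, rfl⟩)
    · exact ⟨[], Or.inl rfl, rfl⟩
    · exact ⟨g :: l, Or.inr ⟨l, rfl, hl⟩, by simp⟩

theorem finite_preimage_quotientGroup_mk {B : Subgroup P} [Finite B] {D : Set (P ⧸ B)}
    (hD : D.Finite) : (((↑) : P → P ⧸ B) ⁻¹' D).Finite := by
  have : Finite D := hD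
  exact Finite.of_equiv _ (QuotientGroup.preimageMkEquivSubgroupProdSet B D).symm

end PrefixCosets

section Amalgam

open Monoid PushoutI
open scoped Pointwise

variable {A ι : Type*} [Group A] {G : ι → Type*} [∀ i, Group (G i)] {φ : ∀ i, A →* G i}

/-- The left cosets `gA` of the amalgamated subgroup; when the `φ i` are injective and there are two
factors, these are the edges of the Bass–Serre tree. -/
abbrev BaseCosets (φ : ∀ i, A →* G i) : Type _ := PushoutI φ ⧸ (base φ).range

theorem mk_base (α : A) : ((base φ α : PushoutI φ) : BaseCosets φ) = (1 : PushoutI φ) :=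
  QuotientGroup.eq.2 (by simp)

/-- `IsGeodesic φ k c E`: there is a reduced sequence `g₁, …, gₙ` (each `gⱼ` lies in a factor and
outside the amalgamated subgroup, and neighbours lie in different factors) such that `c` is the
coset of its product, `E` consists of the cosets of its partial products, and `k` is the index of
the factor of `g₁` (`none` if `n = 0`). In the Bass–Serre tree of an amalgam of two groups, `E` is
the set of edges of the geodesic whose first edge is `A` and whose last edge is `c`. -/
inductive IsGeodesic (φ : ∀ i, A →* G i) : Option ι → BaseCosets φ → Set (BaseCosets φ) → Prop
  | one : IsGeodesic φ none (1 : PushoutI φ) {((1 : PushoutI φ) : BaseCosets φ)}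
  | of_smul {k : Option ι} {c : BaseCosets φ} {E : Set (BaseCosets φ)} (i : ι) (g : G i)
      (hg : g ∉ (φ i).range) (hE : IsGeodesic φ k c E) (hk : k ≠ some i) :
      IsGeodesic φ (some i) ((of i g : PushoutI φ) • c)
        (insert ((1 : PushoutI φ) : BaseCosets φ) ((of i g : PushoutI φ) • E))

namespace IsGeodesic

variable {k : Option ι} {c : BaseCosets φ} {E : Set (BaseCosets φ)}

theorem exists_reduced_word (hE : IsGeodesic φ k c E) :
    ∃ w : CoprodI.Word G, Reduced φ w ∧ w.fstIdx = k ∧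
      ((ofCoprodI w.prod : PushoutI φ) : BaseCosets φ) = c := by
  induction hE with
  | one => exact ⟨.empty, by simp [Reduced, CoprodI.Word.empty], rfl, by simp⟩
  | of_smul i g hg _ hk ih =>
    obtain ⟨w, hw, rfl, rfl⟩ := ih
    have hg1 : g ≠ 1 := fun h => hg (h ▸ one_mem _)
    refine ⟨.cons g w hk hg1, ?_, w.fstIdx_cons g hk hg1, by simp⟩
    exact List.forall_mem_cons.2 ⟨hg, hw⟩

theorem eq_singleton (hφ : ∀ i, Function.Injective (φ i))
    (hE : IsGeodesic φ k (1 : PushoutI φ) E) : E = {((1 : PushoutI φ) : BaseCosets φ)} := by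
  obtain ⟨w, hw, hwk, hw1⟩ := hE.exists_reduced_word
  obtain rfl := hw.eq_empty_of_mem_range hφ (by simpa using QuotientGroup.eq.1 hw1.symm)
  obtain rfl : k = none := hwk.symm
  generalize hc : ((1 : PushoutI φ) : BaseCosets φ) = c at hE
  cases hE
  rfl

theorem base_smul (hE : IsGeodesic φ k c E) (α : A) :
    IsGeodesic φ k (base φ α • c) (base φ α • E) := by
  cases hE with
  | one => simpa [mk_base] using one (φ := φ)
  | of_smul i g hg hE hk =>
    have hαg : φ i α * g ∉ (φ i).range := fun h =>
      hg (((φ i).range.mul_mem_cancel_left ⟨α, rfl⟩).1 h)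
    simpa [of_apply_eq_base, mul_smul, Set.smul_set_insert, mk_base]
      using hE.of_smul i (φ i α * g) hαg hk

theorem exists_of_smul (hE : IsGeodesic φ k c E) (i : ι) (g : G i) :
    ∃ k' F, IsGeodesic φ k' ((of i g : PushoutI φ) • c) F ∧
      (of i g : PushoutI φ) • E ⊆ insert ((of i g : PushoutI φ) : BaseCosets φ) F := by
  by_cases hg : g ∈ (φ i).range
  · obtain ⟨α, rfl⟩ := hg
    rw [of_apply_eq_base]
    exact ⟨k, _, hE.base_smul α, Set.subset_insert _ _⟩
  by_cases hk : k = some i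
  · subst hk
    obtain _ | ⟨_, g', hg', hE', hk'⟩ := hE
    rw [Set.smul_set_insert, ← mul_smul, ← mul_smul, ← map_mul, MulAction.Quotient.smul_mk,
      smul_eq_mul, mul_one]
    by_cases hgg' : g * g' ∈ (φ i).range
    · obtain ⟨α, hα⟩ := hgg'
      rw [← hα, of_apply_eq_base]
      exact ⟨_, _, hE'.base_smul α, subset_rfl⟩
    · exact ⟨_, _, hE'.of_smul i (g * g') hgg' hk',
        Set.insert_subset_insert (Set.subset_insert _ _)⟩
  · exact ⟨_, _, hE.of_smul i g hg hk, (Set.subset_insert _ _).trans (Set.subset_insert _ _)⟩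

theorem exists_finite_smul_subset (g : PushoutI φ) :
    ∃ D : Set (BaseCosets φ), D.Finite ∧ ∀ k c E, IsGeodesic φ k c E →
      ∃ k' F, IsGeodesic φ k' (g • c) F ∧ g • E ⊆ D ∪ F := by
  induction g using PushoutI.induction_on with
  | of i g => exact ⟨_, Set.finite_singleton _, fun k c E hE => hE.exists_of_smul i g⟩
  | base α =>
    exact ⟨∅, Set.finite_empty, fun k c E hE => ⟨k, _, hE.base_smul α, Set.subset_union_right⟩⟩
  | mul g h hg hh =>
    obtain ⟨D, hD, hg⟩ := hg
    obtain ⟨D', hD', hh⟩ := hh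
    refine ⟨D ∪ g • D', hD.union hD'.smul_set, fun k c E hE => ?_⟩
    obtain ⟨_, E', hE', hhE⟩ := hh k c E hE
    obtain ⟨k', F, hF, hgE'⟩ := hg _ _ E' hE'
    refine ⟨k', F, mul_smul g h c ▸ hF, ?_⟩
    calc (g * h) • E = g • h • E := mul_smul g h E
      _ ⊆ g • (D' ∪ E') := Set.smul_set_mono hhE
      _ = g • D' ∪ g • E' := Set.smul_set_union
      _ ⊆ g • D' ∪ (D ∪ F) := Set.union_subset_union_right _ hgE'
      _ = D ∪ g • D' ∪ F := by rw [← Set.union_assoc, Set.union_comm (g • D')]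

end IsGeodesic

theorem exists_isGeodesic_of_isChain (hφ : ∀ i, Function.Injective (φ i)) {gs : List (PushoutI φ)}
    (hfactor : ∀ g ∈ gs, ∃ i, g ∈ (of (φ := φ) i).range) (hbase : ∀ g ∈ gs, g ∉ (base φ).range)
    (halt : gs.IsChain fun g h => ∃ i j, i ≠ j ∧
      g ∈ (of (φ := φ) i).range ∧ h ∈ (of (φ := φ) j).range) :
    ∃ k, IsGeodesic φ k (gs.prod : PushoutI φ) (prefixCosets (base φ).range gs) ∧
      ∀ i, k = some i → ∃ g ∈ gs.head?, g ∈ (of (φ := φ) i).range := by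
  induction gs with
  | nil => exact ⟨none, prefixCosets_nil (base φ).range ▸ .one, by simp⟩
  | cons g gs ih =>
    obtain ⟨hgbase, hbase⟩ := List.forall_mem_cons.1 hbase
    obtain ⟨i, hgi, hhead⟩ : ∃ i, g ∈ (of (φ := φ) i).range ∧
        ∀ h ∈ gs.head?, h ∉ (of (φ := φ) i).range := by
      rcases gs with _ | ⟨h, gs⟩
      · simpa using hfactor g List.mem_cons_self
      · obtain ⟨⟨i, j, hij, hgi, hhj⟩, -⟩ := List.isChain_cons_cons.1 halt
        refine ⟨i, hgi, fun h' hh' hhi => ?_⟩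
        obtain rfl : h = h' := by simpa using hh'
        exact hbase h List.mem_cons_self
          (inf_of_range_eq_base_range hφ hij ▸ Subgroup.mem_inf.2 ⟨hhi, hhj⟩)
    obtain ⟨k, hE, hk⟩ := ih (fun h hh => hfactor h (List.mem_cons_of_mem g hh)) hbase halt.tail
    have hki : k ≠ some i := fun h =>
      let ⟨h', hh', hhi⟩ := hk i h
      hhead h' hh' hhi
    obtain ⟨a, rfl⟩ := hgi
    have ha : a ∉ (φ i).range := fun ⟨α, hα⟩ => hgbase ⟨α, by rw [← hα, of_apply_eq_base]⟩
    refine ⟨some i, ?_, by simp⟩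
    rw [prefixCosets_cons]
    exact hE.of_smul i a ha hki

theorem exists_finite_isGeodesic_subset_smul
    (hφ : ∀ i, Function.Injective (φ i)) {H : Subgroup (PushoutI φ)} (hH : H.FG) :
    ∃ D : Set (BaseCosets φ), D.Finite ∧
      ∀ h ∈ H, ∀ k E, IsGeodesic φ k h E → E ⊆ (H : Set (PushoutI φ)) • D := by
  obtain ⟨S, hS⟩ := (Subgroup.fg_iff_submonoid_fg H).1 hH
  choose D hD hsmul using IsGeodesic.exists_finite_smul_subset (φ := φ)
  have hSH : ∀ s ∈ S, s ∈ H := fun s hs => by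
    rw [← Subgroup.mem_toSubmonoid, ← hS]
    exact Submonoid.subset_closure hs
  refine ⟨insert ((1 : PushoutI φ) : BaseCosets φ) (⋃ s ∈ S, D s⁻¹),
    (S.finite_toSet.biUnion fun s _ => hD s⁻¹).insert _, fun h hh => ?_⟩
  rw [← Subgroup.mem_toSubmonoid, ← hS] at hh
  induction hh using Submonoid.closure_induction_left with
  | one =>
    intro k E hE
    rw [hE.eq_singleton hφ, Set.singleton_subset_iff]
    exact ⟨1, one_mem H, _, Set.mem_insert _ _, one_smul _ _⟩
  | mul_left s hs h _ ih =>
    intro k E hE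
    obtain ⟨k', F, hF, hEF⟩ := hsmul s⁻¹ _ _ E hE
    have hFH := ih k' F (by simpa using hF)
    rw [Set.smul_set_subset_iff_subset_inv_smul_set, inv_inv] at hEF
    refine hEF.trans ?_
    rintro _ ⟨p, hp | hp, rfl⟩
    · exact ⟨s, hSH s hs, p, Set.mem_insert_of_mem _ (Set.mem_biUnion hs hp), rfl⟩
    · obtain ⟨h', hh', d, hd, rfl⟩ := hFH hp
      exact ⟨s * h', mul_mem (hSH s hs) hh', d, hd, mul_smul _ _ _⟩

end Amalgam

section NormalCore

open Monoid PushoutI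
open scoped Pointwise

variable {A : Type*} [Group A] {G : Fin 2 → Type*} [∀ i, Group (G i)] {φ : ∀ i, A →* G i}

theorem IsNormalSeq.exists_isGeodesic (hφ : ∀ i, Function.Injective (φ i))
    {gs : List (PushoutI φ)} (hgs : IsNormalSeq φ gs) {l : List (PushoutI φ)} (hl : l <+: gs) :
    ∃ k E, IsGeodesic φ k (gs.prod : PushoutI φ) E ∧
      ((l.prod : PushoutI φ) : BaseCosets φ) ∈ E := by
  by_cases hbase : ∀ g ∈ gs, g ∉ (base φ).range
  · obtain ⟨k, hE, -⟩ := exists_isGeodesic_of_isChain hφ hgs.mem_factor hbase hgs.alternate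
    exact ⟨k, _, hE, l, hl, rfl⟩
  · push Not at hbase
    obtain ⟨g, hg, α, rfl⟩ := hbase
    have hlength : gs.length = 1 := by
      by_contra h
      exact hgs.notMem_base h _ hg ⟨α, rfl⟩
    obtain ⟨g, rfl⟩ := List.length_eq_one_iff.1 hlength
    obtain rfl := List.mem_singleton.1 hg
    refine ⟨none, _, by simpa [mk_base] using IsGeodesic.one, ?_⟩
    rcases List.prefix_cons_iff.1 hl with rfl | ⟨l', rfl, hl'⟩
    · rfl
    · simp [List.prefix_nil.1 hl', mk_base]

variable {X : Fin 2 → Type*} {x : ∀ i, X i → G i}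

theorem wordVal_amalgamGen_mem_range {i : Fin 2} {w : List ((Σ i, X i) × Bool)}
    (hw : ∀ a ∈ w, a.1.1 = i) : wordVal (amalgamGen φ x) w ∈ (of (φ := φ) i).range :=
  wordVal_mem fun a ha => hw a ha ▸ ⟨x a.1.1 a.1.2, rfl⟩

theorem IsNormalWord.exists_isGeodesic_of_prefix (hφ : ∀ i, Function.Injective (φ i))
    {w l : List ((Σ i, X i) × Bool)} (hw : IsNormalWord φ x w) (hl : l <+: w) :
    ∃ k E, IsGeodesic φ k (wordVal (amalgamGen φ x) w : PushoutI φ) E ∧ ∃ q : PushoutI φ,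
      (q : BaseCosets φ) ∈ E ∧ ∃ g : Σ i, G i, wordVal (amalgamGen φ x) l = q * of g.1 g.2 := by
  obtain ⟨L, ⟨rfl, hmono, -⟩, hnormal⟩ := hw
  obtain ⟨L', v, hL', rfl, hv⟩ := exists_eq_flatten_append_of_prefix_flatten hl
  obtain ⟨k, E, hE, hq⟩ := hnormal.exists_isGeodesic hφ (hL'.map (wordVal (amalgamGen φ x)))
  obtain ⟨i, hi⟩ : ∃ i, ∀ a ∈ v, a.1.1 = i := by
    rcases hv with rfl | ⟨u, hu, hvu⟩
    · exact ⟨0, by simp⟩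
    · exact (hmono u hu).2.imp fun i hi a ha => hi a (hvu.subset ha)
  obtain ⟨g, hg⟩ := wordVal_amalgamGen_mem_range (φ := φ) (x := x) hi
  exact ⟨k, E, wordVal_flatten (amalgamGen φ x) L ▸ hE, _, hq, ⟨i, g⟩, by
    rw [wordVal_append, wordVal_flatten, hg]⟩

theorem finite_setOf_isEssential [∀ i, Finite (G i)] (hφ : ∀ i, Function.Injective (φ i))
    (x : ∀ i, X i → G i) {H : Subgroup (PushoutI φ)} (hH : H.FG) :
    {v | IsEssential φ x H v}.Finite := by
  have : Finite A := Finite.of_injective (φ 0) (hφ 0)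
  have : Finite (base φ).range := Set.finite_range (base φ)
  obtain ⟨D, hD, hgeodesic⟩ := exists_finite_isGeodesic_subset_smul hφ hH
  refine ((finite_preimage_quotientGroup_mk hD).image2
    (fun q g => (Quotient.mk'' (q * of g.1 g.2) : RightCosets H))
    (Set.finite_univ (α := Σ i, G i))).subset ?_
  rintro v ⟨p, hp, hnormal, hv⟩
  obtain ⟨p', hp'p, hp'⟩ := hp.exists_prefix_of_mem_pathVertices hv
  obtain ⟨k, E, hE, q, hq, g, hqg⟩ := IsNormalWord.exists_isGeodesic_of_prefix hφ hnormal
    (hp'p.map (relCayley (amalgamGen φ x) H).lab)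
  obtain ⟨h, hh, d, hd, hhd⟩ :=
    hgeodesic _ (wordVal_pathLabel_mem_of_isPath_base hp) k E hE hq
  refine ⟨h⁻¹ * q, ?_, g, Set.mem_univ g, ?_⟩
  · have hd' : ((h⁻¹ * q : PushoutI φ) : BaseCosets φ) = d := by
      rw [← smul_eq_mul, ← MulAction.Quotient.smul_mk, ← hhd]
      exact inv_smul_smul h d
    exact Set.mem_preimage.2 (hd' ▸ hd)
  · rw [relCayley_eq_mk_of_isPath_base hp']
    refine Quotient.sound (QuotientGroup.rightRel_apply.2 ?_)
    rw [LabelledGraph.pathLabel, hqg]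
    simpa [mul_assoc] using hh

end NormalCore

theorem mainTheorem3_general {A : Type*} [Group A] {G : Fin 2 → Type*} [∀ i, Group (G i)]
    [∀ i, Finite (G i)] (φ : ∀ i, A →* G i) (hφ : ∀ i, Function.Injective (φ i))
    {X : Fin 2 → Type*} [∀ i, Finite (X i)] (x : ∀ i, X i → G i)
    (H : Subgroup (Monoid.PushoutI φ)) (hH : H.FG) :
    (normalCore φ x H).IsFinite :=
  relCayley_restrict_isFinite (finite_setOf_isEssential hφ x hH)

theorem mainTheorem3 {A : Type*} [Group A] {G : Fin 2 → Type*} [∀ i, Group (G i)]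
    [∀ i, Finite (G i)] (φ : ∀ i, A →* G i) (hφ : ∀ i, Function.Injective (φ i))
    {X : Fin 2 → Type*} [∀ i, Finite (X i)] (x : ∀ i, X i → G i)
    (R : ∀ i, Set (FreeGroup (X i))) (hR : ∀ i, (R i).Finite)
    (hpres : ∀ i, IsPresentation (x i) (R i))
    (H : Subgroup (Monoid.PushoutI φ)) (hH : H.FG) :
    (normalCore φ x H).IsFinite :=
  mainTheorem3_general φ hφ x H hH
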